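/- An oriented graph $D$ is a finite set of vertices with a set of arcs (ordered pairs of vertices) that has no loops and never contains both $(u,v)$ and $(v,u)$; write $u\to v$ if $(u,v)$ is an arc. $D$ is connected if its underlying simple graph is connected. Let $\omega=\frac{1+i\sqrt3}{2}$, and let $H_\omega(D)$ be the Hermitian matrix indexed by the vertices of $D$ with $(u,v)$ entry $\omega$ if $u\to v$, $\overline\omega$ if $v\to u$, and $0$ otherwise. Theorem. If $D$ is a connected oriented graph and $H_\omega(D)$ has exactly two distinct eigenvalues, then $D$ is isomorphic to one of the following four graphs: (a) the directed edge $0\to 1$; (b) the directed triangle $0\to 1\to 2\to 0$; (c) the orientation of $K_{3,3}$ with parts $\{u_0,u_1,u_2\}$ and $\{x_0,x_1,x_2\}$ and arcs $u_i\to x_j$ for $i\neq j$ and $x_i\to u_i$ for all $i$; (d) the orientation of $K_{5,5}$ minus the perfect matching $\{u_ix_i : i\in\mathbb Z/5\}$ with parts $\{u_i : i\in\mathbb Z/5\}$ and $\{x_i : i\in\mathbb Z/5\}$ and arcs $u_i\to x_j$ for $j-i=\pm1$ and $x_j\to u_i$ for $j-i=\pm2$. Conversely, each of these four is a connected oriented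 graph, and the sets of distinct eigenvalues of their matrices $H_\omega$ are $\{1,-1\}$, $\{1,-2\}$, $\{\sqrt3,-\sqrt3\}$ and $\{2,-2\}$, respectively. -/

import Mathlib

namespace Digraph

/-- A digraph is an oriented graph if it has no loops and no pair of opposite arcs.
`D.Adj u v` means that `(u, v)` is an arc, `u → v`. -/
structure IsOriented {V : Type*} (D : Digraph V) : Prop where
  loopless : ∀ v, ¬ D.Adj v v
  asymm : ∀ u v, ¬ (D.Adj u v ∧ D.Adj v u)

/-- A digraph is connected if its underlying simple graph is connected. -/
def IsConnected {V : Type*} (D : Digraph V) : Prop :=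
  D.toSimpleGraphInclusive.Connected

/-- Two digraphs are isomorphic if some bijection of the vertices preserves and reflects arcs. -/
def IsIsomorphic {V W : Type*} (D : Digraph V) (D' : Digraph W) : Prop :=
  Nonempty (D.Adj ≃r D'.Adj)

/-- The primitive sixth root of unity `ω = (1 + i√3) / 2`. -/
noncomputable def omega : ℂ := (1 + Complex.I * (Real.sqrt 3 : ℂ)) / 2

open Classical in
/-- The Hermitian adjacency matrix `H_ω(D)` of an oriented graph: the entry `(u, v)` is `ω` if
`u → v`, the conjugate of `ω` if `v → u`, and `0` otherwise. -/
noncomputable def hermitianAdjMatrix {V : Type*} (D : Digraph V) : Matrix V V ℂ :=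
  Matrix.of fun u v =>
    if D.Adj u v then omega
    else if D.Adj v u then (starRingEnd ℂ) omega
    else 0

/-- The set of distinct eigenvalues of `H_ω(D)`. -/
def eigenvalueSet {V : Type*} [Fintype V] (D : Digraph V) : Set ℂ :=
  {θ | Module.End.HasEigenvalue D.hermitianAdjMatrix.mulVecLin θ}

/-- The directed edge `0 → 1`. -/
def directedEdge : Digraph (Fin 2) where
  Adj u v := u = 0 ∧ v = 1

/-- The directed triangle `0 → 1 → 2 → 0`. -/
def directedTriangle : Digraph (Fin 3) where
  Adj u v := v = u + 1

/-- The special orientation of `K_{3,3}`: with parts `u₀, u₁, u₂` and `x₀, x₁, x₂`,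
the arcs are `u_i → x_j` for `i ≠ j`, and `x_i → u_i`. -/
def orientedK33 : Digraph (Fin 3 ⊕ Fin 3) where
  Adj
    | .inl i, .inr j => i ≠ j
    | .inr j, .inl i => i = j
    | _, _ => False

/-- The special orientation of `K_{5,5}` minus a perfect matching: with parts `u_i` and `x_i`
(`i` modulo `5`), the arcs are `u_i → x_j` for `j - i = ±1`, and `x_j → u_i` for `j - i = ±2`. -/
def orientedK55 : Digraph (ZMod 5 ⊕ ZMod 5) where
  Adj
    | .inl i, .inr j => j - i = 1 ∨ j - i = -1
    | .inr j, .inl i => j - i = 2 ∨ j - i = -2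
    | _, _ => False

end Digraph

/-! Two distinct eigenvalues of a Hermitian matrix mean a quadratic relation `H² = aH + b`. Since
`1` and `ω` are linearly independent over the reals, each entry of this relation splits into two
integer identities between numbers of 2-paths and of common neighbours, and `a` and `b` are integers
(`quadraticCounts_of_mul_self`). Everything afterwards is counting.

The diagonal gives total degree `b` at every vertex. Double counting transitive triangles shows that
there are none (`QuadraticCounts.pathCount_eq_zero`), so each arc lies in exactly `-a` directed
triangles. Summing a row of the relation gives `QuadraticCounts.three_mul_sum_outDeg`. If `a ≠ 0`,
in- and out-degrees agree and this forces `a = -1`, `b = 2`. If `a = 0`, a variance computation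
(`QuadraticCounts.sum_sq`) bounds `b` by 4, and `b = 2` fails modulo 3.

In each remaining case a local search finds the arcs of the target inside `D`. Absence of loops,
2-cycles and transitive triangles makes the resulting map injective; equality of degrees and
connectedness make it an isomorphism (`isIsomorphic_of_injective`).

The converse is a finite check of the integer identities, from which the spectrum is read off
(`QuadraticCounts.eigenvalueSet_eq`). -/

namespace Digraph

open Finset Matrix

/-! ### Arithmetic of the sixth root of unity. -/

section Omega

lemma omega_sq : omega ^ 2 = omega - 1 := by
  have h : (Real.sqrt 3 : ℂ) ^ 2 = 3 := by
    rw [← Complex.ofReal_pow, Real.sq_sqrt (by norm_num)]; norm_num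
  rw [omega]
  linear_combination (Complex.I ^ 2 / 4) * h + (3 / 4) * Complex.I_sq

lemma conj_omega : (starRingEnd ℂ) omega = 1 - omega := by
  rw [omega]
  simp only [map_div₀, map_add, map_mul, map_one, Complex.conj_I, Complex.conj_ofReal,
    Complex.conj_ofNat]
  ring

lemma omega_im_ne_zero : omega.im ≠ 0 := by
  have : omega.im = Real.sqrt 3 / 2 := by simp [omega]
  rw [this]; positivity

lemma omega_ne_zero : omega ≠ 0 := fun h => omega_im_ne_zero (by simp [h])

lemma ofReal_add_ofReal_mul_omega_eq_zero {x y : ℝ} (h : (x : ℂ) + y * omega = 0) :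
    x = 0 ∧ y = 0 := by
  have hi := congrArg Complex.im h
  have hr := congrArg Complex.re h
  simp [omega_im_ne_zero] at hi
  subst hi
  simpa using hr

end Omega

/-! ### The quadratic matrix relation as integer counting identities. -/

section Counting

variable {V : Type*} (D : Digraph V) [DecidableRel D.Adj]

/-- The indicator of the arc `(u, v)`. -/
def arcInd (u v : V) : ℤ := if D.Adj u v then 1 else 0

lemma hermitianAdjMatrix_apply {D : Digraph V} [DecidableRel D.Adj] (hD : D.IsOriented) (u v : V) :
    D.hermitianAdjMatrix u v = omega * D.arcInd u v + (1 - omega) * D.arcInd v u := by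
  have := hD.asymm u v
  rw [← conj_omega]
  by_cases h1 : D.Adj u v <;> by_cases h2 : D.Adj v u <;>
    simp_all [hermitianAdjMatrix, arcInd]

lemma hermitianAdjMatrix_isHermitian {D : Digraph V} (hD : D.IsOriented) :
    D.hermitianAdjMatrix.IsHermitian := by
  classical
  ext u v
  rw [Matrix.conjTranspose_apply, hermitianAdjMatrix_apply hD, hermitianAdjMatrix_apply hD,
    ← conj_omega]
  simp
  ring

variable [Fintype V]

/-- The number of directed paths `u → w → v`. -/
def pathCount (u v : V) : ℕ := #{w | D.Adj u w ∧ D.Adj w v}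

/-- The number of common out-neighbours and common in-neighbours of `u` and `v`. -/
def sameCount (u v : V) : ℕ := #{w | D.Adj u w ∧ D.Adj v w} + #{w | D.Adj w u ∧ D.Adj w v}

/-- The out-degree. -/
def outDeg (u : V) : ℕ := #{w | D.Adj u w}

/-- The in-degree. -/
def inDeg (u : V) : ℕ := #{w | D.Adj w u}

lemma pathCount_eq_sum (u v : V) :
    (D.pathCount u v : ℤ) = ∑ w, D.arcInd u w * D.arcInd w v := by
  simp [pathCount, arcInd, ← ite_and, and_comm]

lemma sameCount_eq_sum (u v : V) :
    (D.sameCount u v : ℤ) =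
      ∑ w, (D.arcInd u w * D.arcInd v w + D.arcInd w u * D.arcInd w v) := by
  simp [sameCount, arcInd, ← ite_and, and_comm, sum_add_distrib]

lemma outDeg_eq_sum (u : V) : (D.outDeg u : ℤ) = ∑ w, D.arcInd u w := by
  simp [outDeg, arcInd]

lemma inDeg_eq_sum (u : V) : (D.inDeg u : ℤ) = ∑ w, D.arcInd w u := by
  simp [inDeg, arcInd]

/-- The entrywise form of `H_ω(D) ^ 2 = a H_ω(D) + b`. -/
def QuadraticCounts [DecidableEq V] (a b : ℤ) : Prop :=
  ∀ u v, (D.pathCount u v : ℤ) - D.pathCount v u = a * (D.arcInd u v - D.arcInd v u) ∧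
    (D.sameCount u v : ℤ) = D.pathCount u v + a * D.arcInd v u + if u = v then b else 0

variable {D}

lemma hermitianAdjMatrix_mul_self_apply (hD : D.IsOriented) (u v : V) :
    (D.hermitianAdjMatrix * D.hermitianAdjMatrix) u v =
      (omega - 1) * D.pathCount u v - omega * D.pathCount v u + D.sameCount u v := by
  have h1 := congrArg (Int.cast : ℤ → ℂ) (D.pathCount_eq_sum u v)
  have h2 := congrArg (Int.cast : ℤ → ℂ) (D.pathCount_eq_sum v u)
  have h3 := congrArg (Int.cast : ℤ → ℂ) (D.sameCount_eq_sum u v)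
  push_cast at h1 h2 h3
  rw [h1, h2, h3, Matrix.mul_apply, mul_sum, mul_sum, ← sum_sub_distrib, ← sum_add_distrib]
  refine sum_congr rfl fun w _ => ?_
  rw [hermitianAdjMatrix_apply hD, hermitianAdjMatrix_apply hD]
  linear_combination ((D.arcInd u w : ℂ) * D.arcInd w v + D.arcInd w u * D.arcInd v w
    - D.arcInd u w * D.arcInd v w - D.arcInd w u * D.arcInd w v) * omega_sq

variable [DecidableEq V]

lemma QuadraticCounts.mul_self (hD : D.IsOriented) {a b : ℤ} (h : D.QuadraticCounts a b) :
    D.hermitianAdjMatrix * D.hermitianAdjMatrix =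
      (a : ℂ) • D.hermitianAdjMatrix + (b : ℂ) • (1 : Matrix V V ℂ) := by
  ext u v
  have h1 := congrArg (Int.cast : ℤ → ℂ) (h u v).1
  have h2 := congrArg (Int.cast : ℤ → ℂ) (h u v).2
  push_cast at h1 h2
  rw [hermitianAdjMatrix_mul_self_apply hD, Matrix.add_apply, Matrix.smul_apply,
    Matrix.smul_apply, hermitianAdjMatrix_apply hD, Matrix.one_apply]
  simp only [smul_eq_mul, mul_ite, mul_one, mul_zero]
  linear_combination omega * h1 + h2

lemma quadraticCounts_of_mul_self (hD : D.IsOriented) {x y : V} (hxy : D.Adj x y) {a b : ℂ}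
    (h : D.hermitianAdjMatrix * D.hermitianAdjMatrix =
      a • D.hermitianAdjMatrix + b • (1 : Matrix V V ℂ)) :
    ∃ a b : ℤ, D.QuadraticCounts a b := by
  have key (u v : V) : (omega - 1) * D.pathCount u v - omega * D.pathCount v u + D.sameCount u v
      = a * (omega * D.arcInd u v + (1 - omega) * D.arcInd v u) + if u = v then b else 0 := by
    rw [← hermitianAdjMatrix_mul_self_apply hD, h, ← hermitianAdjMatrix_apply hD]
    simp [Matrix.one_apply]
  have hyx : ¬ D.Adj y x := fun h => hD.asymm x y ⟨hxy, h⟩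
  have hne : x ≠ y := by rintro rfl; exact hD.loopless _ hxy
  have hsc : D.sameCount y x = D.sameCount x y := by simp only [sameCount, and_comm]
  have k1 := key x y
  have k2 := key y x
  have hl : ¬ D.Adj x x := hD.loopless x
  have k3 := key x x
  simp only [arcInd, hxy, hyx, hl, hne, hne.symm, if_true, if_false, hsc] at k1 k2 k3
  push_cast at k1 k2 k3
  -- Adding the entries at `(x, y)` and `(y, x)` eliminates `ω`, because `ω` and its conjugate sum
  -- to 1; the existence of an arc is what makes `a` an integer.
  have ha : a = ((2 * D.sameCount x y - D.pathCount x y - D.pathCount y x : ℤ) : ℂ) := by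
    push_cast
    linear_combination -k1 - k2
  have hb : b = ((D.sameCount x x - D.pathCount x x : ℤ) : ℂ) := by
    push_cast
    linear_combination -k3
  generalize (2 * D.sameCount x y - D.pathCount x y - D.pathCount y x : ℤ) = a' at ha
  generalize (D.sameCount x x - D.pathCount x x : ℤ) = b' at hb
  subst ha hb
  refine ⟨a', b', fun u v => ?_⟩
  have hk := key u v
  obtain ⟨h1, h2⟩ := ofReal_add_ofReal_mul_omega_eq_zero
    (x := (D.sameCount u v - D.pathCount u v - a' * D.arcInd v u - if u = v then b' else 0 : ℤ))
    (y := (D.pathCount u v - D.pathCount v u - a' * (D.arcInd u v - D.arcInd v u) : ℤ)) (by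
      split_ifs at hk ⊢ <;> push_cast <;> linear_combination hk)
  constructor
  · have := Int.cast_eq_zero.1 h2
    linarith
  · have := Int.cast_eq_zero.1 h1
    linarith

end Counting


/-! ### Two eigenvalues versus a quadratic relation. -/

section Spectrum

/-- The first factor annihilates the range of the second, so any nonzero vector in the range of `H -
β` is an eigenvector for `α`; the factors commute, which gives the same for `β`. -/
lemma eigenvalueSet_eq_of_mul_eq_zero {V : Type*} [Fintype V] [DecidableEq V] {D : Digraph V}
    {α β : ℂ} (h : (D.hermitianAdjMatrix - α • (1 : Matrix V V ℂ)) *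
      (D.hermitianAdjMatrix - β • (1 : Matrix V V ℂ)) = 0)
    (hα : D.hermitianAdjMatrix ≠ α • (1 : Matrix V V ℂ))
    (hβ : D.hermitianAdjMatrix ≠ β • (1 : Matrix V V ℂ)) :
    D.eigenvalueSet = {α, β} := by
  set H := D.hermitianAdjMatrix with hH
  have attained {α β : ℂ} (h : (H - α • (1 : Matrix V V ℂ)) * (H - β • (1 : Matrix V V ℂ)) = 0)
      (hβ : H ≠ β • (1 : Matrix V V ℂ)) : α ∈ D.eigenvalueSet := by
    obtain ⟨w, hw⟩ : ∃ w, (H - β • (1 : Matrix V V ℂ)) *ᵥ w ≠ 0 := by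
      by_contra! hc
      exact hβ (sub_eq_zero.1 (Matrix.ext_of_mulVec_single fun i => by rw [hc, zero_mulVec]))
    refine Module.End.hasEigenvalue_of_hasEigenvector
      (x := (H - β • (1 : Matrix V V ℂ)) *ᵥ w) ⟨?_, hw⟩
    rw [Module.End.mem_eigenspace_iff, Matrix.mulVecLin_apply, ← hH, ← sub_eq_zero]
    have := congrArg (· *ᵥ w) h
    simpa [← Matrix.mulVec_mulVec, Matrix.sub_mulVec, Matrix.smul_mulVec] using this
  have hcomm : (H - β • (1 : Matrix V V ℂ)) * (H - α • (1 : Matrix V V ℂ)) = 0 := by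
    rw [← h]
    simp only [sub_mul, mul_sub, smul_mul_assoc, mul_smul_comm, one_mul, mul_one, smul_sub,
      smul_comm α β]
    abel
  ext θ
  simp only [Set.mem_insert_iff, Set.mem_singleton_iff]
  constructor
  · intro hθ
    obtain ⟨w, hw, hw0⟩ := Module.End.HasEigenvalue.exists_hasEigenvector hθ
    rw [Module.End.mem_eigenspace_iff, Matrix.mulVecLin_apply, ← hH] at hw
    have := congrArg (· *ᵥ w) h
    simp only [← Matrix.mulVec_mulVec, Matrix.sub_mulVec, Matrix.smul_mulVec, one_mulVec, hw,
      zero_mulVec, ← sub_smul, mulVec_smul, smul_smul, smul_eq_zero, hw0, or_false, mul_eq_zero,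
      sub_eq_zero] at this
    tauto
  · rintro (rfl | rfl)
    · exact attained h hβ
    · exact attained hcomm hα

/-- A Hermitian matrix has an orthonormal eigenbasis, and `(H - α)(H - β)` kills each of its
vectors. -/
lemma mul_self_of_eigenvalueSet_ncard {V : Type*} [Fintype V] [DecidableEq V] {D : Digraph V}
    (hH : D.hermitianAdjMatrix.IsHermitian) (h2 : D.eigenvalueSet.ncard = 2) :
    ∃ a b : ℂ, D.hermitianAdjMatrix * D.hermitianAdjMatrix =
      a • D.hermitianAdjMatrix + b • (1 : Matrix V V ℂ) := by
  obtain ⟨α, β, -, hs⟩ := Set.ncard_eq_two.1 h2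
  refine ⟨α + β, -(α * β), ?_⟩
  have hE (j : V) : (hH.eigenvalues j : ℂ) = α ∨ (hH.eigenvalues j : ℂ) = β := by
    have : (hH.eigenvalues j : ℂ) ∈ D.eigenvalueSet := by
      refine Module.End.hasEigenvalue_of_hasEigenvector
        (x := (hH.eigenvectorBasis j : V → ℂ)) ⟨?_, ?_⟩
      · rw [Module.End.mem_eigenspace_iff, Matrix.mulVecLin_apply, hH.mulVec_eigenvectorBasis]
        rfl
      · intro h0
        exact hH.eigenvectorBasis.orthonormal.ne_zero j (by ext i; exact congrFun h0 i)
    rwa [hs] at this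
  rw [← sub_eq_zero]
  set M := D.hermitianAdjMatrix * D.hermitianAdjMatrix -
    ((α + β) • D.hermitianAdjMatrix + (-(α * β)) • (1 : Matrix V V ℂ)) with hM
  have hz : Matrix.toEuclideanLin M = 0 := by
    refine hH.eigenvectorBasis.toBasis.ext fun j => ?_
    have hj := hH.mulVec_eigenvectorBasis j
    have : M *ᵥ (hH.eigenvectorBasis j : V → ℂ) = 0 := by
      have hj' : D.hermitianAdjMatrix *ᵥ (hH.eigenvectorBasis j : V → ℂ) =
        (hH.eigenvalues j : ℂ) • (hH.eigenvectorBasis j : V → ℂ) := hj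
      rw [hM, sub_mulVec, add_mulVec, ← mulVec_mulVec, hj', mulVec_smul, hj', smul_mulVec, hj',
        smul_mulVec, one_mulVec, smul_smul, smul_smul, ← add_smul, ← sub_smul]
      rcases hE j with h | h <;> rw [h] <;> ring_nf <;> simp
    ext i
    simpa using congrFun this i
  simpa using hz

lemma eigenvalueSet_subset_of_forall_not_adj {V : Type*} [Fintype V] {D : Digraph V}
    (h : ∀ u v, ¬ D.Adj u v) : D.eigenvalueSet ⊆ {0} := by
  have h0 : D.hermitianAdjMatrix = 0 := by ext u v; simp [hermitianAdjMatrix, h]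
  intro θ hθ
  obtain ⟨w, hw, hw0⟩ := Module.End.HasEigenvalue.exists_hasEigenvector hθ
  rw [Module.End.mem_eigenspace_iff, Matrix.mulVecLin_apply, h0, zero_mulVec] at hw
  simpa [hw0] using hw.symm

lemma exists_quadraticCounts {V : Type*} [Fintype V] [DecidableEq V] {D : Digraph V}
    [DecidableRel D.Adj] (hD : D.IsOriented) (h2 : D.eigenvalueSet.ncard = 2) :
    ∃ x y, D.Adj x y ∧ ∃ a b : ℤ, D.QuadraticCounts a b := by
  obtain ⟨x, y, hxy⟩ : ∃ x y, D.Adj x y := by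
    by_contra! hc
    have := Set.ncard_le_ncard (eigenvalueSet_subset_of_forall_not_adj hc)
    simp [h2] at this
  obtain ⟨a, b, hab⟩ := mul_self_of_eigenvalueSet_ncard (hermitianAdjMatrix_isHermitian hD) h2
  exact ⟨x, y, hxy, quadraticCounts_of_mul_self hD hxy hab⟩

lemma QuadraticCounts.eigenvalueSet_eq {V : Type*} [Fintype V] [DecidableEq V] {D : Digraph V}
    [DecidableRel D.Adj] (hD : D.IsOriented) {a b : ℤ} (h : D.QuadraticCounts a b) {x y : V}
    (hxy : D.Adj x y) {α β : ℂ} (hs : α + β = a) (hp : α * β = -b) :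
    D.eigenvalueSet = {α, β} := by
  have hne (γ : ℂ) : D.hermitianAdjMatrix ≠ γ • (1 : Matrix V V ℂ) := by
    intro hc
    have hxyne : x ≠ y := by rintro rfl; exact hD.loopless _ hxy
    have := congrFun (congrFun hc x) y
    simp [hermitianAdjMatrix, hxy, Matrix.one_apply_ne hxyne, omega_ne_zero] at this
  refine eigenvalueSet_eq_of_mul_eq_zero ?_ (hne α) (hne β)
  have hb : (b : ℂ) = -(α * β) := by rw [hp]; ring
  simp only [sub_mul, mul_sub, smul_mul_assoc, mul_smul_comm, one_mul, mul_one, h.mul_self hD,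
    ← hs, hb, add_smul, neg_smul, mul_smul, smul_sub, smul_comm α β]
  abel

end Spectrum

/-! ### The four graphs: connectedness, underlying graphs and spectra. -/

section Targets

instance : DecidableRel directedEdge.Adj := fun u v =>
  inferInstanceAs (Decidable (u = 0 ∧ v = 1))

instance : DecidableRel directedTriangle.Adj := fun u v =>
  inferInstanceAs (Decidable (v = u + 1))

instance : DecidableRel orientedK33.Adj
  | .inl i, .inr j => inferInstanceAs (Decidable (i ≠ j))
  | .inr j, .inl i => inferInstanceAs (Decidable (i = j))
  | .inl _, .inl _ => inferInstanceAs (Decidable False)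
  | .inr _, .inr _ => inferInstanceAs (Decidable False)

instance : DecidableRel orientedK55.Adj
  | .inl i, .inr j => inferInstanceAs (Decidable (j - i = 1 ∨ j - i = -1))
  | .inr j, .inl i => inferInstanceAs (Decidable (j - i = 2 ∨ j - i = -2))
  | .inl _, .inl _ => inferInstanceAs (Decidable False)
  | .inr _, .inr _ => inferInstanceAs (Decidable False)

instance {V : Type*} [Fintype V] [DecidableEq V] (D : Digraph V) [DecidableRel D.Adj] (a b : ℤ) :
    Decidable (D.QuadraticCounts a b) :=
  inferInstanceAs (Decidable (∀ _ _, _))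

lemma directedEdge_isOriented : directedEdge.IsOriented := ⟨by decide, by decide⟩

lemma directedTriangle_isOriented : directedTriangle.IsOriented := ⟨by decide, by decide⟩

lemma orientedK33_isOriented : orientedK33.IsOriented := ⟨by decide, by decide⟩

lemma orientedK55_isOriented : orientedK55.IsOriented := ⟨by decide, by decide⟩

/-- Every vertex of the four targets is within distance 3 of a root; bounding the distance turns
connectedness into a decidable statement. -/
lemma isConnected_of_forall_path {V : Type*} {D : Digraph V} (hD : D.IsOriented) (r : V)
    (h : ∀ v, v ≠ r → ∃ a b, (D.Adj r a ∨ D.Adj a r) ∧ (a = b ∨ D.Adj a b ∨ D.Adj b a) ∧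
      (b = v ∨ D.Adj b v ∨ D.Adj v b)) : D.IsConnected := by
  have step {u v : V} (h : D.Adj u v ∨ D.Adj v u) :
      D.toSimpleGraphInclusive.Reachable u v := by
    refine SimpleGraph.Adj.reachable ?_
    have : u ≠ v := by rintro rfl; exact hD.loopless u (by tauto)
    simpa [Digraph.toSimpleGraphInclusive, this] using h
  have step' {u v : V} (h : u = v ∨ D.Adj u v ∨ D.Adj v u) :
      D.toSimpleGraphInclusive.Reachable u v := by
    rcases h with rfl | h
    · rfl
    · exact step h
  refine (SimpleGraph.connected_iff_exists_forall_reachable _).2 ⟨r, fun v => ?_⟩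
  by_cases hv : v = r
  · rw [hv]
  · obtain ⟨a, b, h1, h2, h3⟩ := h v hv
    exact ((step h1).trans (step' h2)).trans (step' h3)

lemma directedEdge_isConnected : directedEdge.IsConnected :=
  isConnected_of_forall_path directedEdge_isOriented 0 (by decide)

lemma directedTriangle_isConnected : directedTriangle.IsConnected :=
  isConnected_of_forall_path directedTriangle_isOriented 0 (by decide)

lemma orientedK33_isConnected : orientedK33.IsConnected :=
  isConnected_of_forall_path orientedK33_isOriented (.inl 0) (by decide)

lemma orientedK55_isConnected : orientedK55.IsConnected :=
  isConnected_of_forall_path orientedK55_isOriented (.inl 0) (by decide)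

lemma directedEdge_eigenvalueSet : directedEdge.eigenvalueSet = {1, -1} :=
  QuadraticCounts.eigenvalueSet_eq directedEdge_isOriented
    (show directedEdge.QuadraticCounts 0 1 by decide)
    (show directedEdge.Adj 0 1 by decide) (by norm_num) (by norm_num)

lemma directedTriangle_eigenvalueSet : directedTriangle.eigenvalueSet = {1, -2} :=
  QuadraticCounts.eigenvalueSet_eq directedTriangle_isOriented
    (show directedTriangle.QuadraticCounts (-1) 2 by decide)
    (show directedTriangle.Adj 0 1 by decide) (by norm_num) (by norm_num)

lemma orientedK33_eigenvalueSet :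
    orientedK33.eigenvalueSet = {(Real.sqrt 3 : ℂ), -(Real.sqrt 3 : ℂ)} :=
  QuadraticCounts.eigenvalueSet_eq orientedK33_isOriented
    (show orientedK33.QuadraticCounts 0 3 by decide)
    (show orientedK33.Adj (.inl 0) (.inr 1) by decide) (by simp) (by
      rw [mul_neg, ← Complex.ofReal_mul, Real.mul_self_sqrt (by norm_num)]; norm_num)

lemma orientedK55_eigenvalueSet : orientedK55.eigenvalueSet = {2, -2} :=
  QuadraticCounts.eigenvalueSet_eq orientedK55_isOriented
    (show orientedK55.QuadraticCounts 0 4 by decide +kernel)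
    (show orientedK55.Adj (.inl 0) (.inr 1) by decide) (by norm_num) (by norm_num)

lemma orientedK33_toSimpleGraphInclusive :
    orientedK33.toSimpleGraphInclusive = _root_.completeBipartiteGraph (Fin 3) (Fin 3) := by
  ext u v
  have : (u ≠ v ∧ (orientedK33.Adj u v ∨ orientedK33.Adj v u)) ↔
      ((u.isLeft ∧ v.isRight) ∨ (u.isRight ∧ v.isLeft)) := by
    revert u v; decide
  simpa [Digraph.toSimpleGraphInclusive, _root_.completeBipartiteGraph] using this

lemma orientedK55_toSimpleGraphInclusive :
    orientedK55.toSimpleGraphInclusive =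
      (_root_.completeBipartiteGraph (ZMod 5) (ZMod 5)).deleteEdges
        (Set.range fun i : ZMod 5 => s(Sum.inl i, Sum.inr i)) := by
  ext u v
  have : (u ≠ v ∧ (orientedK55.Adj u v ∨ orientedK55.Adj v u)) ↔
      (((u.isLeft ∧ v.isRight) ∨ (u.isRight ∧ v.isLeft)) ∧
        ¬ ∃ i : ZMod 5, (Sum.inl i = u ∧ Sum.inr i = v) ∨ (Sum.inl i = v ∧ Sum.inr i = u)) := by
    revert u v; decide +kernel
  simpa [Digraph.toSimpleGraphInclusive, _root_.completeBipartiteGraph] using this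

end Targets


/-! ### Degree constraints from double counting. -/

section Classification

variable {V : Type*} {D : Digraph V} [DecidableRel D.Adj]

lemma arcInd_nonneg (D : Digraph V) [DecidableRel D.Adj] (u v : V) : 0 ≤ D.arcInd u v := by
  unfold arcInd; split_ifs <;> norm_num

lemma arcInd_mul_arcInd_swap (hD : D.IsOriented) (u v : V) :
    D.arcInd u v * D.arcInd v u = 0 := by
  have := hD.asymm u v
  unfold arcInd; split_ifs <;> simp_all

variable [Fintype V]

lemma pathCount_pos_iff (u v : V) : 0 < D.pathCount u v ↔ ∃ w, D.Adj u w ∧ D.Adj w v := by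
  simp [pathCount, card_pos, Finset.Nonempty]

lemma pathCount_self (hD : D.IsOriented) (u : V) : D.pathCount u u = 0 := by
  simpa [pathCount, filter_eq_empty_iff] using fun w h h' => hD.asymm u w ⟨h, h'⟩

lemma sameCount_self (u : V) : D.sameCount u u = D.outDeg u + D.inDeg u := by
  simp [sameCount, outDeg, inDeg]

lemma sum_outDeg_eq_sum_inDeg : ∑ u, (D.outDeg u : ℤ) = ∑ u, (D.inDeg u : ℤ) := by
  simp only [outDeg_eq_sum, inDeg_eq_sum]
  exact sum_comm

lemma sum_pathCount_right (D : Digraph V) [DecidableRel D.Adj] (u : V) :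
    ∑ v, (D.pathCount u v : ℤ) = ∑ w, D.arcInd u w * D.outDeg w := by
  simp only [pathCount_eq_sum, outDeg_eq_sum, mul_sum]
  exact sum_comm

lemma sum_pathCount_left (D : Digraph V) [DecidableRel D.Adj] (u : V) :
    ∑ v, (D.pathCount v u : ℤ) = ∑ w, D.arcInd w u * D.inDeg w := by
  simp only [pathCount_eq_sum, inDeg_eq_sum, mul_sum]
  rw [sum_comm]
  exact sum_congr rfl fun _ _ => sum_congr rfl fun _ _ => by ring

variable [DecidableEq V] {a b : ℤ}

lemma QuadraticCounts.outDeg_add_inDeg (h : D.QuadraticCounts a b) (hD : D.IsOriented) (u : V) :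
    (D.outDeg u : ℤ) + D.inDeg u = b := by
  have := (h u u).2
  rw [sameCount_self, pathCount_self hD] at this
  simpa [arcInd, hD.loopless] using this

/-- Let `t` be the number of transitive triangles. Summing `pathCount` over arcs counts each at its
long arc and gives `t`; summing `sameCount` over arcs counts each at its two short arcs and gives
`2t`. The relation makes the two counts equal on every arc, so `t = 0`. -/
lemma QuadraticCounts.pathCount_eq_zero (h : D.QuadraticCounts a b) (hD : D.IsOriented) {u v : V}
    (huv : D.Adj u v) : D.pathCount u v = 0 := by
  have hS : ∑ x, ∑ y, D.arcInd x y * D.sameCount x y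
      = 2 * ∑ x, ∑ y, D.arcInd x y * D.pathCount x y := by
    have e1 : ∑ x, ∑ y, ∑ w, D.arcInd x y * (D.arcInd x w * D.arcInd y w)
        = ∑ x, ∑ y, ∑ w, D.arcInd x y * (D.arcInd x w * D.arcInd w y) := by
      refine sum_congr rfl fun x _ => ?_
      rw [sum_comm]
      exact sum_congr rfl fun y _ => sum_congr rfl fun w _ => by ring
    have e2 : ∑ x, ∑ y, ∑ w, D.arcInd x y * (D.arcInd w x * D.arcInd w y)
        = ∑ x, ∑ y, ∑ w, D.arcInd x y * (D.arcInd x w * D.arcInd w y) := by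
      calc _ = ∑ x, ∑ w, ∑ y, D.arcInd x y * (D.arcInd w x * D.arcInd w y) :=
            sum_congr rfl fun x _ => sum_comm
        _ = ∑ w, ∑ x, ∑ y, D.arcInd x y * (D.arcInd w x * D.arcInd w y) := sum_comm
        _ = ∑ w, ∑ y, ∑ x, D.arcInd x y * (D.arcInd w x * D.arcInd w y) :=
            sum_congr rfl fun x _ => sum_comm
        _ = _ := sum_congr rfl fun x _ => sum_congr rfl fun y _ => sum_congr rfl fun w _ => by ring
    simp only [sameCount_eq_sum, pathCount_eq_sum, sum_add_distrib, mul_add, mul_sum]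
    rw [e1, e2, ← two_mul]
    simp only [mul_sum]
  have hS' : ∑ x, ∑ y, D.arcInd x y * D.sameCount x y
      = ∑ x, ∑ y, D.arcInd x y * D.pathCount x y := by
    refine sum_congr rfl fun x _ => sum_congr rfl fun y _ => ?_
    rw [(h x y).2]
    have h1 := arcInd_mul_arcInd_swap hD x y
    split_ifs with hxy
    · subst hxy
      simp [arcInd, hD.loopless]
    · linear_combination a * h1
  have h0 : ∑ x, ∑ y, D.arcInd x y * (D.pathCount x y : ℤ) = 0 := by linarith
  have hn (x y : V) : 0 ≤ D.arcInd x y * (D.pathCount x y : ℤ) :=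
    mul_nonneg (D.arcInd_nonneg x y) (Int.natCast_nonneg _)
  rw [sum_eq_zero_iff_of_nonneg fun x _ => sum_nonneg fun y _ => hn x y] at h0
  have h1 := h0 u (mem_univ u)
  rw [sum_eq_zero_iff_of_nonneg fun y _ => hn u y] at h1
  simpa [arcInd, huv] using h1 v (mem_univ v)

lemma QuadraticCounts.pathCount_swap (h : D.QuadraticCounts a b) (hD : D.IsOriented) {u v : V}
    (huv : D.Adj u v) : (D.pathCount v u : ℤ) = -a := by
  have := (h u v).1
  have hvu : ¬ D.Adj v u := fun hvu => hD.asymm u v ⟨huv, hvu⟩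
  simp [h.pathCount_eq_zero hD huv, arcInd, huv, hvu] at this
  linarith

/-- Both sides are, up to sign, the number of directed triangles through `u`, counted by the arc
leaving `u` or by the arc entering it; each arc lies in `-a` of them. -/
lemma QuadraticCounts.mul_outDeg_eq_mul_inDeg (h : D.QuadraticCounts a b) (hD : D.IsOriented)
    (u : V) : a * (D.outDeg u : ℤ) = a * D.inDeg u := by
  have e1 : ∑ v, D.arcInd u v * (D.pathCount v u : ℤ) = -a * D.outDeg u := by
    rw [outDeg_eq_sum, mul_sum]
    refine sum_congr rfl fun v _ => ?_
    by_cases huv : D.Adj u v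
    · rw [h.pathCount_swap hD huv]; ring
    · simp [arcInd, huv]
  have e2 : ∑ v, D.arcInd v u * (D.pathCount u v : ℤ) = -a * D.inDeg u := by
    rw [inDeg_eq_sum, mul_sum]
    refine sum_congr rfl fun v _ => ?_
    by_cases huv : D.Adj v u
    · rw [h.pathCount_swap hD huv]; ring
    · simp [arcInd, huv]
  have e3 : ∑ v, D.arcInd u v * (D.pathCount v u : ℤ)
      = ∑ v, D.arcInd v u * (D.pathCount u v : ℤ) := by
    simp only [pathCount_eq_sum, mul_sum]
    rw [sum_comm]
    exact sum_congr rfl fun _ _ => sum_congr rfl fun _ _ => by ring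
  linarith

lemma QuadraticCounts.sum_in_eq_sum_out (h : D.QuadraticCounts a b) (hD : D.IsOriented) (u : V) :
    ∑ w, D.arcInd w u * (D.inDeg w : ℤ) = ∑ w, D.arcInd u w * D.outDeg w := by
  have e : ∑ v, ((D.pathCount u v : ℤ) - D.pathCount v u)
      = ∑ v, a * (D.arcInd u v - D.arcInd v u) := sum_congr rfl fun v _ => (h u v).1
  rw [sum_sub_distrib, ← mul_sum, sum_sub_distrib, sum_pathCount_left, sum_pathCount_right,
    ← outDeg_eq_sum, ← inDeg_eq_sum] at e
  have := h.mul_outDeg_eq_mul_inDeg hD u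
  linarith

/-- Write `X` for the sum on the left. Summing `sameCount u v` over `v` and replacing degrees by
their complements to `b` gives `b² - 2X`, where `sum_in_eq_sum_out` identifies the two sums that
appear. The other side of the relation sums to `X + a * inDeg u + b`. -/
lemma QuadraticCounts.three_mul_sum_outDeg (h : D.QuadraticCounts a b) (hD : D.IsOriented)
    (u : V) : 3 * ∑ w, D.arcInd u w * (D.outDeg w : ℤ) = b ^ 2 - b - a * D.inDeg u := by
  have e : ∑ v, (D.sameCount u v : ℤ) = ∑ v, ((D.pathCount u v : ℤ) + a * D.arcInd v u +
      if u = v then b else 0) := sum_congr rfl fun v _ => (h u v).2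
  have e' : ∑ v, (D.sameCount u v : ℤ)
      = ∑ w, D.arcInd u w * (D.inDeg w : ℤ) + ∑ w, D.arcInd w u * (D.outDeg w : ℤ) := by
    simp only [sameCount_eq_sum, outDeg_eq_sum, inDeg_eq_sum, mul_sum]
    rw [sum_comm]
    simp only [sum_add_distrib]
  have hdeg := h.outDeg_add_inDeg hD
  have e1 : ∑ w, D.arcInd u w * (D.inDeg w : ℤ)
      = b * D.outDeg u - ∑ w, D.arcInd u w * (D.outDeg w : ℤ) := by
    rw [outDeg_eq_sum, mul_sum, ← sum_sub_distrib]
    exact sum_congr rfl fun w _ => by rw [← hdeg w]; ring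
  have e2 : ∑ w, D.arcInd w u * (D.outDeg w : ℤ)
      = b * D.inDeg u - ∑ w, D.arcInd w u * (D.inDeg w : ℤ) := by
    rw [inDeg_eq_sum, mul_sum, ← sum_sub_distrib]
    exact sum_congr rfl fun w _ => by rw [← hdeg w]; ring
  have e3 := h.sum_in_eq_sum_out hD u
  rw [sum_add_distrib, sum_add_distrib, ← mul_sum, sum_pathCount_right, ← inDeg_eq_sum,
    sum_ite_eq, if_pos (mem_univ _), e', e1, e2, e3] at e
  have := hdeg u
  linear_combination -e + b * this

lemma QuadraticCounts.of_ne_zero (h : D.QuadraticCounts a b) (hD : D.IsOriented) {x y : V}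
    (hxy : D.Adj x y) (ha : a ≠ 0) : a = -1 ∧ ∀ u, D.outDeg u = 1 ∧ D.inDeg u = 1 := by
  have hdeg := h.outDeg_add_inDeg hD
  have heq (u : V) : (D.outDeg u : ℤ) = D.inDeg u :=
    mul_left_cancel₀ ha (h.mul_outDeg_eq_mul_inDeg hD u)
  have hb (u : V) : 2 * (D.outDeg u : ℤ) = b := by linarith [hdeg u, heq u]
  have hpos : 0 < D.outDeg x := card_pos.2 ⟨y, by simpa using hxy⟩
  have hbpos : 0 < b := by have := hb x; omega
  have hX : 2 * ∑ w, D.arcInd x w * (D.outDeg w : ℤ) = b * D.outDeg x := by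
    rw [outDeg_eq_sum, mul_sum, mul_sum]
    exact sum_congr rfl fun w _ => by rw [← hb w]; ring
  have h3 := h.three_mul_sum_outDeg hD x
  have hprod : b * (b - 4 - 2 * a) = 0 := by
    linear_combination (-4) * h3 + 6 * hX + (3 * b + 2 * a) * hb x - 4 * a * heq x
  -- Since `-a` is a count and `a ≠ 0`, positivity of `b` leaves only `a = -1`.
  have hb4 : b = 4 + 2 * a := by
    rcases mul_eq_zero.1 hprod with h | h <;> omega
  have hneg := h.pathCount_swap hD hxy
  have ha1 : a = -1 := by omega
  refine ⟨ha1, fun u => ?_⟩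
  have := hb u
  have := heq u
  omega

/-- As in- and out-degree sum to `b`, each square is `b² - 4 * inDeg * outDeg`; summing
`three_mul_sum_outDeg` over all vertices evaluates the sum of these products. -/
lemma QuadraticCounts.sum_sq (h : D.QuadraticCounts 0 b) (hD : D.IsOriented) :
    3 * ∑ u, (2 * (D.outDeg u : ℤ) - b) ^ 2 = Fintype.card V * (b * (4 - b)) := by
  have hdeg := h.outDeg_add_inDeg hD
  have hsum : 2 * ∑ u, (D.outDeg u : ℤ) = Fintype.card V * b := by
    rw [two_mul]
    nth_rewrite 2 [sum_outDeg_eq_sum_inDeg]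
    rw [← sum_add_distrib, sum_congr rfl fun u _ => hdeg u]
    simp
  have hprod : 3 * ∑ u, (D.inDeg u : ℤ) * D.outDeg u = Fintype.card V * (b ^ 2 - b) := by
    have : ∑ u, ∑ w, D.arcInd u w * (D.outDeg w : ℤ) = ∑ u, (D.inDeg u : ℤ) * D.outDeg u := by
      rw [sum_comm]
      simp only [inDeg_eq_sum, sum_mul]
    rw [← this, mul_sum, sum_congr rfl fun u _ => h.three_mul_sum_outDeg hD u]
    simp
    ring
  have e : ∑ u, (2 * (D.outDeg u : ℤ) - b) ^ 2 = Fintype.card V * b ^ 2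
      - 4 * ∑ u, (D.inDeg u : ℤ) * D.outDeg u := by
    have : (Fintype.card V : ℤ) * b ^ 2 = ∑ _u : V, b ^ 2 := by simp
    rw [this, mul_sum, ← sum_sub_distrib]
    exact sum_congr rfl fun u _ => by rw [← hdeg u]; ring
  rw [e]
  linear_combination (-4) * hprod

lemma QuadraticCounts.degree_cases (h : D.QuadraticCounts 0 b) (hD : D.IsOriented) {x y : V}
    (hxy : D.Adj x y) : b = 1 ∨ (b = 3 ∧ ∀ u, D.outDeg u = 1 ∨ D.outDeg u = 2) ∨
      (b = 4 ∧ ∀ u, D.outDeg u = 2 ∧ D.inDeg u = 2) := by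
  have hdeg := h.outDeg_add_inDeg hD
  have hsq := h.sum_sq hD
  have hpos : 0 < D.outDeg x := card_pos.2 ⟨y, by simpa using hxy⟩
  have hbpos : 0 < b := by have := hdeg x; omega
  have hn : (0 : ℤ) < Fintype.card V := by exact_mod_cast Fintype.card_pos_iff.2 ⟨x⟩
  have hle : b ≤ 4 := by
    by_contra! hc
    have h1 : 0 ≤ ∑ u, (2 * (D.outDeg u : ℤ) - b) ^ 2 := sum_nonneg fun u _ => sq_nonneg _
    nlinarith [mul_pos hn (mul_pos hbpos (sub_pos.2 hc))]
  have h3 := h.three_mul_sum_outDeg hD x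
  have hb : b = 1 ∨ b = 2 ∨ b = 3 ∨ b = 4 := by omega
  rcases hb with rfl | rfl | rfl | rfl
  · exact .inl rfl
  -- Here `three_mul_sum_outDeg` would make 2 a multiple of 3.
  · omega
  · refine .inr (.inl ⟨rfl, fun u => ?_⟩)
    have h0 : ∑ u, ((2 * (D.outDeg u : ℤ) - 3) ^ 2 - 1) = 0 := by
      rw [sum_sub_distrib]; simp; linarith
    -- Odd squares are at least 1 and their average is 1, so all of them equal 1.
    have hnn (u : V) : 0 ≤ (2 * (D.outDeg u : ℤ) - 3) ^ 2 - 1 := by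
      have : 2 * (D.outDeg u : ℤ) - 3 ≤ -1 ∨ 1 ≤ 2 * (D.outDeg u : ℤ) - 3 := by omega
      rcases this with h | h <;> nlinarith
    have hu := (sum_eq_zero_iff_of_nonneg fun u _ => hnn u).1 h0 u (mem_univ u)
    have : ((D.outDeg u : ℤ) - 1) * (D.outDeg u - 2) = 0 := by linarith
    rcases mul_eq_zero.1 this with h | h <;> omega
  · refine .inr (.inr ⟨rfl, fun u => ?_⟩)
    have h0 : ∑ u, (2 * (D.outDeg u : ℤ) - 4) ^ 2 = 0 := by linarith
    have hu := (sum_eq_zero_iff_of_nonneg fun u _ => sq_nonneg _).1 h0 u (mem_univ u)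
    have := pow_eq_zero_iff (two_ne_zero) |>.1 hu
    have := hdeg u
    omega

end Classification

/-! ### From an arc-preserving map to an isomorphism. -/

section Embedding

/-- In an oriented graph without transitive triangles, distinct vertices with one of these
configurations have distinct images under an arc-preserving map. -/
def Separated {W : Type*} (T : Digraph W) : Prop :=
  ∀ a b, a ≠ b → T.Adj a b ∨ T.Adj b a ∨ (∃ c, T.Adj a c ∧ T.Adj c b) ∨
    ∃ c d, T.Adj a c ∧ T.Adj c d ∧ T.Adj b d

/-- Identifying `a` with `b` would turn the four configurations into a loop, a loop, a 2-cycle and a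
transitive triangle respectively. -/
lemma Separated.injective {V W : Type*} {T : Digraph W} {D : Digraph V} (hT : T.Separated)
    (hD : D.IsOriented) (htr : ∀ p q r, D.Adj p q → D.Adj q r → ¬ D.Adj p r) {f : W → V}
    (hf : ∀ a b, T.Adj a b → D.Adj (f a) (f b)) : Function.Injective f := by
  intro a b hab
  by_contra hne
  rcases hT a b hne with h | h | ⟨c, h1, h2⟩ | ⟨c, d, h1, h2, h3⟩
  · have h' := hf _ _ h
    rw [hab] at h'
    exact hD.loopless _ h'
  · have h' := hf _ _ h
    rw [hab] at h'
    exact hD.loopless _ h'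
  · have h1' := hf _ _ h1
    rw [hab] at h1'
    exact hD.asymm _ _ ⟨h1', hf _ _ h2⟩
  · have h1' := hf _ _ h1
    rw [hab] at h1'
    exact htr _ _ _ h1' (hf _ _ h2) (hf _ _ h3)

/-- The degree bound leaves no room for neighbours of an image vertex outside the image, nor for
extra arcs inside it. The image is therefore closed under adjacency, hence everything by
connectedness. -/
lemma isIsomorphic_of_injective {V W : Type*} [Fintype V] [Fintype W] [Nonempty W]
    {T : Digraph W} [DecidableRel T.Adj] {D : Digraph V} [DecidableRel D.Adj]
    (hc : D.IsConnected) {f : W → V} (hinj : Function.Injective f)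
    (hf : ∀ a b, T.Adj a b → D.Adj (f a) (f b))
    (hdeg : ∀ a, D.outDeg (f a) + D.inDeg (f a) ≤ T.outDeg a + T.inDeg a) :
    D.IsIsomorphic T := by
  classical
  have hsub1 (a : W) : (univ.filter (T.Adj a ·)).image f ⊆ univ.filter (D.Adj (f a) ·) := by
    simpa [subset_iff] using fun b h => hf a b h
  have hsub2 (a : W) : (univ.filter (T.Adj · a)).image f ⊆ univ.filter (D.Adj · (f a)) := by
    simpa [subset_iff] using fun b h => hf b a h
  have hc1 (a : W) : T.outDeg a ≤ D.outDeg (f a) := by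
    rw [outDeg, ← card_image_of_injective _ hinj]; exact card_le_card (hsub1 a)
  have hc2 (a : W) : T.inDeg a ≤ D.inDeg (f a) := by
    rw [inDeg, ← card_image_of_injective _ hinj]; exact card_le_card (hsub2 a)
  have heq1 (a : W) : (univ.filter (T.Adj a ·)).image f = univ.filter (D.Adj (f a) ·) := by
    refine eq_of_subset_of_card_le (hsub1 a) ?_
    rw [card_image_of_injective _ hinj]
    have := hc2 a; have := hdeg a
    change D.outDeg (f a) ≤ T.outDeg a
    omega
  have heq2 (a : W) : (univ.filter (T.Adj · a)).image f = univ.filter (D.Adj · (f a)) := by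
    refine eq_of_subset_of_card_le (hsub2 a) ?_
    rw [card_image_of_injective _ hinj]
    have := hc1 a; have := hdeg a
    change D.inDeg (f a) ≤ T.inDeg a
    omega
  have hout (a : W) (v : V) (h : D.Adj (f a) v) : ∃ b, T.Adj a b ∧ f b = v := by
    have : v ∈ univ.filter (D.Adj (f a) ·) := by simpa using h
    simpa [← heq1] using this
  have hin (a : W) (v : V) (h : D.Adj v (f a)) : ∃ b, T.Adj b a ∧ f b = v := by
    have : v ∈ univ.filter (D.Adj · (f a)) := by simpa using h
    simpa [← heq2] using this
  have hsurj : Function.Surjective f := by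
    intro v
    obtain ⟨a⟩ := ‹Nonempty W›
    obtain ⟨p⟩ := hc.preconnected v (f a)
    suffices ∀ x y, D.toSimpleGraphInclusive.Walk x y → y ∈ Set.range f → x ∈ Set.range f from
      this _ _ p ⟨a, rfl⟩
    intro x y p
    induction p with
    | nil => exact id
    | @cons z _ _ h _ ih =>
      intro hy
      obtain ⟨c, hc⟩ := ih hy
      subst hc
      have h' : D.Adj z (f c) ∨ D.Adj (f c) z := by
        simp [Digraph.toSimpleGraphInclusive] at h
        tauto
      rcases h' with h' | h'
      · obtain ⟨e, -, he⟩ := hin _ _ h'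
        exact ⟨e, he⟩
      · obtain ⟨e, -, he⟩ := hout _ _ h'
        exact ⟨e, he⟩
  let e : T.Adj ≃r D.Adj := ⟨Equiv.ofBijective f ⟨hinj, hsurj⟩, fun {a b} => by
    refine ⟨fun h => ?_, hf a b⟩
    obtain ⟨b', hb', he⟩ := hout _ _ h
    rwa [← hinj he]⟩
  exact ⟨e.symm⟩

lemma directedEdge_separated : directedEdge.Separated := by unfold Separated; decide

lemma directedTriangle_separated : directedTriangle.Separated := by unfold Separated; decide

lemma orientedK33_separated : orientedK33.Separated := by unfold Separated; decide

lemma orientedK55_separated : orientedK55.Separated := by unfold Separated; decide +kernel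

lemma directedEdge_degree (a : Fin 2) : directedEdge.outDeg a + directedEdge.inDeg a = 1 := by
  revert a; decide

lemma directedTriangle_degree (a : Fin 3) :
    directedTriangle.outDeg a + directedTriangle.inDeg a = 2 := by
  revert a; decide

lemma orientedK33_degree (a : Fin 3 ⊕ Fin 3) : orientedK33.outDeg a + orientedK33.inDeg a = 3 := by
  revert a; decide

lemma orientedK55_degree (a : ZMod 5 ⊕ ZMod 5) :
    orientedK55.outDeg a + orientedK55.inDeg a = 4 := by
  revert a; decide +kernel

end Embedding


/-! ### Reconstructing the graph in each surviving case. -/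

section SmallDegree

variable {V : Type*} [Fintype V] {D : Digraph V} [DecidableRel D.Adj]

lemma exists_ne_adj_of_outDeg_eq_two {u : V} (h : D.outDeg u = 2) (x : V) :
    ∃ y, y ≠ x ∧ D.Adj u y := by
  obtain ⟨y, hy, hne⟩ := exists_mem_ne (by rw [← outDeg, h]; norm_num) x
    (s := univ.filter (D.Adj u ·))
  exact ⟨y, hne, by simpa using hy⟩

lemma exists_ne_adj_of_inDeg_eq_two {u : V} (h : D.inDeg u = 2) (x : V) :
    ∃ y, y ≠ x ∧ D.Adj y u := by
  obtain ⟨y, hy, hne⟩ := exists_mem_ne (by rw [← inDeg, h]; norm_num) x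
    (s := univ.filter (D.Adj · u))
  exact ⟨y, hne, by simpa using hy⟩

lemma eq_or_eq_of_outDeg_eq_two {u x y w : V} (h : D.outDeg u = 2) (hxy : x ≠ y)
    (hx : D.Adj u x) (hy : D.Adj u y) (hw : D.Adj u w) : w = x ∨ w = y := by
  classical
  have : {x, y} = univ.filter (D.Adj u ·) := by
    refine eq_of_subset_of_card_le (by simp [insert_subset_iff, hx, hy]) ?_
    rw [← outDeg, h, card_pair hxy]
  have hw' : w ∈ univ.filter (D.Adj u ·) := by simpa using hw
  simpa [← this] using hw'

lemma eq_or_eq_of_inDeg_eq_two {u x y w : V} (h : D.inDeg u = 2) (hxy : x ≠ y)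
    (hx : D.Adj x u) (hy : D.Adj y u) (hw : D.Adj w u) : w = x ∨ w = y := by
  classical
  have : {x, y} = univ.filter (D.Adj · u) := by
    refine eq_of_subset_of_card_le (by simp [insert_subset_iff, hx, hy]) ?_
    rw [← inDeg, h, card_pair hxy]
  have hw' : w ∈ univ.filter (D.Adj · u) := by simpa using hw
  simpa [← this] using hw'

lemma eq_of_outDeg_eq_one {u x y : V} (h : D.outDeg u = 1) (hx : D.Adj u x) (hy : D.Adj u y) :
    x = y :=
  card_le_one.1 h.le x (by simpa using hx) y (by simpa using hy)

lemma eq_of_inDeg_eq_one {u x y : V} (h : D.inDeg u = 1) (hx : D.Adj x u) (hy : D.Adj y u) :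
    x = y :=
  card_le_one.1 h.le x (by simpa using hx) y (by simpa using hy)

lemma exists_adj_of_outDeg_pos {u : V} (h : 0 < D.outDeg u) : ∃ x, D.Adj u x := by
  obtain ⟨x, hx⟩ := card_pos.1 h
  exact ⟨x, by simpa using hx⟩

lemma exists_adj_of_inDeg_pos {u : V} (h : 0 < D.inDeg u) : ∃ x, D.Adj x u := by
  obtain ⟨x, hx⟩ := card_pos.1 h
  exact ⟨x, by simpa using hx⟩

variable [DecidableEq V] {b : ℤ}

lemma QuadraticCounts.exists_reverse_path (h : D.QuadraticCounts 0 b) {u v w : V}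
    (h1 : D.Adj u w) (h2 : D.Adj w v) : ∃ z, D.Adj v z ∧ D.Adj z u := by
  rw [← pathCount_pos_iff]
  have := (pathCount_pos_iff u v).2 ⟨w, h1, h2⟩
  have := (h u v).1
  omega

lemma QuadraticCounts.exists_common (h : D.QuadraticCounts 0 b) (hD : D.IsOriented) {u v w : V}
    (h1 : D.Adj u w) (h2 : D.Adj w v) :
    ∃ z, (D.Adj u z ∧ D.Adj v z) ∨ (D.Adj z u ∧ D.Adj z v) := by
  have huv : u ≠ v := by rintro rfl; exact hD.asymm _ _ ⟨h1, h2⟩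
  have hp := (pathCount_pos_iff u v).2 ⟨w, h1, h2⟩
  have hs := (h u v).2
  rw [if_neg huv] at hs
  by_contra! hc
  have : D.sameCount u v = 0 := by
    simp only [sameCount, Nat.add_eq_zero_iff, card_eq_zero, filter_eq_empty_iff]
    exact ⟨fun w _ hw => (hc w).1 hw.1 hw.2, fun w _ hw => (hc w).2 hw.1 hw.2⟩
  omega

lemma QuadraticCounts.exists_path_of_out (h : D.QuadraticCounts 0 b) {u v w : V} (huv : u ≠ v)
    (h1 : D.Adj u w) (h2 : D.Adj v w) : ∃ z, D.Adj u z ∧ D.Adj z v := by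
  rw [← pathCount_pos_iff]
  have hs := (h u v).2
  have : 0 < #{w | D.Adj u w ∧ D.Adj v w} := card_pos.2 ⟨w, by simp [h1, h2]⟩
  rw [if_neg huv, sameCount] at hs
  omega

lemma QuadraticCounts.exists_path_of_in (h : D.QuadraticCounts 0 b) {u v w : V} (huv : u ≠ v)
    (h1 : D.Adj w u) (h2 : D.Adj w v) : ∃ z, D.Adj u z ∧ D.Adj z v := by
  rw [← pathCount_pos_iff]
  have hs := (h u v).2
  have : 0 < #{w | D.Adj w u ∧ D.Adj w v} := card_pos.2 ⟨w, by simp [h1, h2]⟩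
  rw [if_neg huv, sameCount] at hs
  omega

/-- With `a = 0`, `pathCount u v`, `pathCount v u` and `sameCount u v` are all equal. They count
disjoint sets of neighbours of `u`, so three times the common value is at most `b < 6`. -/
lemma QuadraticCounts.sameCount_le_one (h : D.QuadraticCounts 0 b) (hD : D.IsOriented)
    (hb : b < 6) {u v : V} (huv : u ≠ v) : D.sameCount u v ≤ 1 := by
  have h1 := h u v
  have h2 := h.outDeg_add_inDeg hD u
  have ho : D.pathCount u v + #{w | D.Adj u w ∧ D.Adj v w} ≤ D.outDeg u := by
    rw [pathCount, outDeg, ← card_union_of_disjoint]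
    · exact card_le_card fun w => by simp; tauto
    · rw [disjoint_filter]
      exact fun w _ hw hw' => hD.asymm _ _ ⟨hw.2, hw'.2⟩
  have hi : D.pathCount v u + #{w | D.Adj w u ∧ D.Adj w v} ≤ D.inDeg u := by
    rw [pathCount, inDeg, ← card_union_of_disjoint]
    · exact card_le_card fun w => by simp; tauto
    · rw [disjoint_filter]
      exact fun w _ hw hw' => hD.asymm _ _ ⟨hw.1, hw'.2⟩
  rw [if_neg huv] at h1
  have hs : D.sameCount u v = #{w | D.Adj u w ∧ D.Adj v w} + #{w | D.Adj w u ∧ D.Adj w v} := rfl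
  omega

lemma QuadraticCounts.not_common_out_and_in (h : D.QuadraticCounts 0 b) (hD : D.IsOriented)
    (hb : b < 6) {u v w z : V} (huv : u ≠ v) (h1 : D.Adj u w) (h2 : D.Adj v w)
    (h3 : D.Adj z u) (h4 : D.Adj z v) : False := by
  have hs := h.sameCount_le_one hD hb huv
  have ho : 0 < #{w | D.Adj u w ∧ D.Adj v w} := card_pos.2 ⟨w, by simp [h1, h2]⟩
  have hi : 0 < #{w | D.Adj w u ∧ D.Adj w v} := card_pos.2 ⟨z, by simp [h3, h4]⟩
  rw [sameCount] at hs
  omega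

lemma QuadraticCounts.not_adj_of_adj_adj {a : ℤ} (h : D.QuadraticCounts a b) (hD : D.IsOriented)
    (p q r : V) (h1 : D.Adj p q) (h2 : D.Adj q r) : ¬ D.Adj p r := fun h3 =>
  ((pathCount_pos_iff p r).2 ⟨q, h1, h2⟩).ne' (h.pathCount_eq_zero hD h3)

lemma QuadraticCounts.isIsomorphic {W : Type*} [Fintype W] [Nonempty W] {T : Digraph W}
    [DecidableRel T.Adj] {a : ℤ} {k : ℕ} (h : D.QuadraticCounts a k) (hD : D.IsOriented)
    (hc : D.IsConnected) (hT : T.Separated) (hdeg : ∀ a, T.outDeg a + T.inDeg a = k) (f : W → V)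
    (hf : ∀ a b, T.Adj a b → D.Adj (f a) (f b)) : D.IsIsomorphic T := by
  refine isIsomorphic_of_injective hc (hT.injective hD (h.not_adj_of_adj_adj hD) hf) hf ?_
  intro a
  have := h.outDeg_add_inDeg hD (f a)
  have := hdeg a
  omega

lemma QuadraticCounts.isIsomorphic_directedEdge (h : D.QuadraticCounts 0 1) (hD : D.IsOriented)
    (hc : D.IsConnected) {x y : V} (hxy : D.Adj x y) : D.IsIsomorphic directedEdge := by
  refine h.isIsomorphic (k := 1) hD hc directedEdge_separated directedEdge_degree ![x, y] ?_
  rintro a b ⟨rfl, rfl⟩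
  exact hxy

lemma QuadraticCounts.isIsomorphic_directedTriangle (h : D.QuadraticCounts (-1) 2)
    (hD : D.IsOriented) (hc : D.IsConnected) {x y : V} (hxy : D.Adj x y) :
    D.IsIsomorphic directedTriangle := by
  have hp := h.pathCount_swap hD hxy
  obtain ⟨z, hyz, hzx⟩ := (pathCount_pos_iff (D := D) y x).1 (by omega)
  refine h.isIsomorphic (k := 2) hD hc directedTriangle_separated directedTriangle_degree
    ![x, y, z] ?_
  rintro a b rfl
  fin_cases a <;> assumption

lemma QuadraticCounts.isIsomorphic_orientedK33_of_arcs (h : D.QuadraticCounts 0 3)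
    (hD : D.IsOriented) (hc : D.IsConnected) {u₀ u₁ u₂ x₀ x₁ x₂ : V}
    (h01 : D.Adj u₀ x₁) (h02 : D.Adj u₀ x₂) (h10 : D.Adj u₁ x₀) (h12 : D.Adj u₁ x₂)
    (h20 : D.Adj u₂ x₀) (h21 : D.Adj u₂ x₁) (h00 : D.Adj x₀ u₀) (h11 : D.Adj x₁ u₁)
    (h22 : D.Adj x₂ u₂) : D.IsIsomorphic orientedK33 := by
  refine h.isIsomorphic (k := 3) hD hc orientedK33_separated orientedK33_degree
    (Sum.elim ![u₀, u₁, u₂] ![x₀, x₁, x₂]) ?_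
  rintro (a | a) (b | b) hab
  · exact hab.elim
  · fin_cases a <;> fin_cases b <;> first | assumption | exact absurd rfl hab
  · obtain rfl : b = a := hab
    fin_cases b <;> assumption
  · exact hab.elim

lemma QuadraticCounts.isIsomorphic_orientedK55_of_arcs (h : D.QuadraticCounts 0 4)
    (hD : D.IsOriented) (hc : D.IsConnected) {u₀ u₁ u₂ u₃ u₄ x₀ x₁ x₂ x₃ x₄ : V}
    (h01 : D.Adj u₀ x₁) (h04 : D.Adj u₀ x₄) (h12 : D.Adj u₁ x₂) (h10 : D.Adj u₁ x₀)
    (h23 : D.Adj u₂ x₃) (h21 : D.Adj u₂ x₁) (h34 : D.Adj u₃ x₄) (h32 : D.Adj u₃ x₂)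
    (h40 : D.Adj u₄ x₀) (h43 : D.Adj u₄ x₃) (k02 : D.Adj x₀ u₂) (k03 : D.Adj x₀ u₃)
    (k13 : D.Adj x₁ u₃) (k14 : D.Adj x₁ u₄) (k24 : D.Adj x₂ u₄) (k20 : D.Adj x₂ u₀)
    (k30 : D.Adj x₃ u₀) (k31 : D.Adj x₃ u₁) (k41 : D.Adj x₄ u₁) (k42 : D.Adj x₄ u₂) :
    D.IsIsomorphic orientedK55 := by
  refine h.isIsomorphic (k := 4) hD hc orientedK55_separated orientedK55_degree
    (Sum.elim ![u₀, u₁, u₂, u₃, u₄] ![x₀, x₁, x₂, x₃, x₄]) ?_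
  rintro (a | a) (b | b) hab
  · exact hab.elim
  · change Fin 5 at a b
    fin_cases a <;> fin_cases b <;> first | assumption | exact absurd hab (by decide)
  · change Fin 5 at a b
    fin_cases a <;> fin_cases b <;> first | assumption | exact absurd hab (by decide)
  · exact hab.elim

/-- The out-degrees of the out-neighbours of `u` sum to 2: a single out-neighbour has out-degree 2,
and each of two has out-degree 1. -/
lemma QuadraticCounts.outDeg_add_outDeg (h : D.QuadraticCounts 0 3) (hD : D.IsOriented)
    (ho : ∀ u, D.outDeg u = 1 ∨ D.outDeg u = 2) {u v : V} (huv : D.Adj u v) :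
    D.outDeg u + D.outDeg v = 3 := by
  have h3 := h.three_mul_sum_outDeg hD u
  have hsum : ∑ w, D.arcInd u w * ((D.outDeg w : ℤ) - (3 - D.outDeg u)) = 0 := by
    simp only [mul_sub (D.arcInd u _), sum_sub_distrib, ← sum_mul, ← outDeg_eq_sum]
    rcases ho u with hu | hu <;> rw [hu] <;> push_cast <;> linarith
  have hterm : D.arcInd u v * ((D.outDeg v : ℤ) - (3 - D.outDeg u)) = 0 := by
    rcases ho u with hu | hu
    · refine (sum_eq_zero_iff_of_nonpos fun w _ => ?_).1 hsum v (mem_univ v)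
      have := ho w
      exact mul_nonpos_of_nonneg_of_nonpos (D.arcInd_nonneg u w) (by omega)
    · refine (sum_eq_zero_iff_of_nonneg fun w _ => ?_).1 hsum v (mem_univ v)
      have := ho w
      exact mul_nonneg (D.arcInd_nonneg u w) (by omega)
  simp only [arcInd, huv, if_true] at hterm
  omega

lemma QuadraticCounts.isIsomorphic_orientedK33 (h : D.QuadraticCounts 0 3) (hD : D.IsOriented)
    (hc : D.IsConnected) (ho : ∀ u, D.outDeg u = 1 ∨ D.outDeg u = 2) {x y : V}
    (hxy : D.Adj x y) : D.IsIsomorphic orientedK33 := by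
  have hdeg := h.outDeg_add_inDeg hD
  have harc {u v : V} (huv : D.Adj u v) := h.outDeg_add_outDeg hD ho huv
  obtain ⟨u₀, hu₀⟩ : ∃ u, D.outDeg u = 2 := by
    have := harc hxy
    rcases ho x with h | h
    · exact ⟨y, by omega⟩
    · exact ⟨x, h⟩
  obtain ⟨x₁, h01⟩ := exists_adj_of_outDeg_pos (D := D) (u := u₀) (by omega)
  obtain ⟨x₂, hne, h02⟩ := exists_ne_adj_of_outDeg_eq_two hu₀ x₁
  have hi₀ : D.inDeg u₀ = 1 := by have := hdeg u₀; omega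
  obtain ⟨x₀, h00⟩ := exists_adj_of_inDeg_pos (D := D) (u := u₀) (by omega)
  have hx₀ : D.inDeg x₀ = 2 := by have := hdeg x₀; have := harc h00; omega
  obtain ⟨u₁, h10⟩ := exists_adj_of_inDeg_pos (D := D) (u := x₀) (by omega)
  obtain ⟨u₂, hne', h20⟩ := exists_ne_adj_of_inDeg_eq_two hx₀ u₁
  -- The path `u → x₀ → u₀` forces a return path through `x₁` or `x₂`, and a common neighbour of `u`
  -- and `u₀`. The latter cannot be an in-neighbour, since `x₀` is the only one of `u₀`; so it is
  -- the other of `x₁`, `x₂`.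
  have side {u : V} (hu : D.Adj u x₀) :
      (D.Adj x₁ u ∧ D.Adj u x₂) ∨ (D.Adj x₂ u ∧ D.Adj u x₁) := by
    obtain ⟨w, hw1, hw2⟩ := h.exists_reverse_path hu h00
    obtain ⟨z, ⟨hz1, hz2⟩ | ⟨hz1, hz2⟩⟩ := h.exists_common hD hu h00
    · rcases eq_or_eq_of_outDeg_eq_two hu₀ hne.symm h01 h02 hw1 with rfl | rfl <;>
        rcases eq_or_eq_of_outDeg_eq_two hu₀ hne.symm h01 h02 hz2 with rfl | rfl
      · exact (hD.asymm _ _ ⟨hw2, hz1⟩).elim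
      · exact .inl ⟨hw2, hz1⟩
      · exact .inr ⟨hw2, hz1⟩
      · exact (hD.asymm _ _ ⟨hw2, hz1⟩).elim
    · obtain rfl := eq_of_inDeg_eq_one hi₀ hz2 h00
      exact (hD.asymm _ _ ⟨hu, hz1⟩).elim
  have hx₁ : D.outDeg x₁ = 1 := by have := harc h01; omega
  have hx₂ : D.outDeg x₂ = 1 := by have := harc h02; omega
  -- Both in-neighbours of `x₀` cannot be on the same side, as `x₁` and `x₂` have out-degree 1; the
  -- two mixed cases differ by swapping `u₁` and `u₂`.
  rcases side h10 with ⟨h1, h2⟩ | ⟨h1, h2⟩ <;> rcases side h20 with ⟨h3, h4⟩ | ⟨h3, h4⟩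
  · exact (hne' (eq_of_outDeg_eq_one hx₁ h3 h1)).elim
  · exact h.isIsomorphic_orientedK33_of_arcs hD hc h01 h02 h10 h2 h20 h4 h00 h1 h3
  · exact h.isIsomorphic_orientedK33_of_arcs hD hc h01 h02 h20 h4 h10 h2 h00 h3 h1
  · exact (hne' (eq_of_outDeg_eq_one hx₂ h3 h1)).elim

lemma QuadraticCounts.isIsomorphic_orientedK55 (h : D.QuadraticCounts 0 4) (hD : D.IsOriented)
    (hc : D.IsConnected) (hdeg : ∀ u, D.outDeg u = 2 ∧ D.inDeg u = 2) (u₀ : V) :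
    D.IsIsomorphic orientedK55 := by
  have as {u v : V} (h1 : D.Adj u v) (h2 : D.Adj v u) : False := hD.asymm u v ⟨h1, h2⟩
  have ho (u : V) := (hdeg u).1
  have hi (u : V) := (hdeg u).2
  have contra {u v w z : V} (huv : u ≠ v) (h1 : D.Adj u w) (h2 : D.Adj v w) (h3 : D.Adj z u)
      (h4 : D.Adj z v) : False := h.not_common_out_and_in hD (by norm_num) huv h1 h2 h3 h4
  obtain ⟨x₁, h01⟩ := exists_adj_of_outDeg_pos (D := D) (u := u₀) (by rw [ho]; norm_num)
  obtain ⟨x₄, hx14, h04⟩ := exists_ne_adj_of_outDeg_eq_two (ho u₀) x₁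
  obtain ⟨x₂, k20⟩ := exists_adj_of_inDeg_pos (D := D) (u := u₀) (by rw [hi]; norm_num)
  obtain ⟨x₃, hx23, k30⟩ := exists_ne_adj_of_inDeg_eq_two (hi u₀) x₂
  obtain ⟨u₂, hu02, h21⟩ := exists_ne_adj_of_inDeg_eq_two (hi x₁) u₀
  obtain ⟨u₃, hu03, h34⟩ := exists_ne_adj_of_inDeg_eq_two (hi x₄) u₀
  have out₀ {w : V} (hw : D.Adj u₀ w) := eq_or_eq_of_outDeg_eq_two (ho u₀) hx14.symm h01 h04 hw
  have in₀ {w : V} (hw : D.Adj w u₀) := eq_or_eq_of_inDeg_eq_two (hi u₀) hx23.symm k20 k30 hw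
  have k42 : D.Adj x₄ u₂ := by
    obtain ⟨w, hw, hw'⟩ := h.exists_path_of_out hu02.symm h01 h21
    rcases out₀ hw with rfl | rfl
    · exact (as h21 hw').elim
    · exact hw'
  have k13 : D.Adj x₁ u₃ := by
    obtain ⟨w, hw, hw'⟩ := h.exists_path_of_out hu03.symm h04 h34
    rcases out₀ hw with rfl | rfl
    · exact hw'
    · exact (as h34 hw').elim
  obtain ⟨u₁, hu12, k41⟩ := exists_ne_adj_of_outDeg_eq_two (ho x₄) u₂
  obtain ⟨u₄, hu34, k14⟩ := exists_ne_adj_of_outDeg_eq_two (ho x₁) u₃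
  -- The two in-neighbours of `u₀` were named in arbitrary order, so this is stated for fresh `x₂`,
  -- `x₃` and applied in whichever order fits.
  have key {x₂ x₃ : V} (k20 : D.Adj x₂ u₀) (k30 : D.Adj x₃ u₀)
      (in₀ : ∀ {w}, D.Adj w u₀ → w = x₂ ∨ w = x₃)
      (k24 : D.Adj x₂ u₄) (h43 : D.Adj u₄ x₃) (k31 : D.Adj x₃ u₁) (h12 : D.Adj u₁ x₂) :
      D.IsIsomorphic orientedK55 := by
    have h22 : ¬ D.Adj u₂ x₂ := fun h22 => contra hu12 h12 h22 k41 k42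
    have h23 : D.Adj u₂ x₃ := by
      obtain ⟨w, hw, hw'⟩ := h.exists_reverse_path h04 k42
      rcases in₀ hw' with rfl | rfl
      · exact (h22 hw).elim
      · exact hw
    have h32 : D.Adj u₃ x₂ := by
      obtain ⟨w, hw, hw'⟩ := h.exists_reverse_path h01 k13
      rcases in₀ hw' with rfl | rfl
      · exact hw
      · exact (contra hu34 h43 hw k14 k13).elim
    obtain ⟨x₀, hx04, k02⟩ := exists_ne_adj_of_inDeg_eq_two (hi u₂) x₄
    have in₂ {w : V} (hw : D.Adj w u₂) := eq_or_eq_of_inDeg_eq_two (hi u₂) hx04 k02 k42 hw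
    have h10 : D.Adj u₁ x₀ := by
      obtain ⟨w, hw, hw'⟩ := h.exists_path_of_in hu12 k41 k42
      rcases in₂ hw' with rfl | rfl
      · exact hw
      · exact (as hw k41).elim
    have k03 : D.Adj x₀ u₃ := by
      obtain ⟨w, ⟨hw, hw'⟩ | ⟨hw, hw'⟩⟩ := h.exists_common hD h21 k13
      · have hx42 : x₄ ≠ x₂ := by rintro rfl; exact as h04 k20
        rcases eq_or_eq_of_outDeg_eq_two (ho u₃) hx42 h34 h32 hw' with rfl | rfl
        · exact (as hw k42).elim
        · exact (h22 hw).elim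
      · rcases in₂ hw with rfl | rfl
        · exact hw'
        · exact (as hw' h34).elim
    have h40 : D.Adj u₄ x₀ := by
      obtain ⟨w, hw, hw'⟩ := h.exists_reverse_path h21 k14
      rcases in₂ hw' with rfl | rfl
      · exact hw
      · rcases eq_or_eq_of_inDeg_eq_two (hi w) hu03 h34 h04 hw with rfl | rfl
        · exact (hu34 rfl).elim
        · exact (as h01 k14).elim
    exact h.isIsomorphic_orientedK55_of_arcs hD hc h01 h04 h12 h10 h23 h21 h34 h32 h40 h43 k02 k03
      k13 k14 k24 k20 k30 k31 k41 k42
  -- The common in-neighbour `x` yields a path from `u₀` to `e` through `x₁` or `x₄`, so `e` is one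
  -- of the `uᵢ`. The choices `u₂` and `u₃` share an out-neighbour with `u₀` as well, which `contra`
  -- forbids.
  have second {x e : V} (hx : D.Adj x u₀) (he : e ≠ u₀) (hxe : D.Adj x e) : e = u₁ ∨ e = u₄ := by
    obtain ⟨w, hw, hw'⟩ := h.exists_path_of_in he.symm hx hxe
    rcases out₀ hw with rfl | rfl
    · rcases eq_or_eq_of_outDeg_eq_two (ho w) hu34 k14 k13 hw' with rfl | rfl
      · exact .inr rfl
      · exact (contra he h34 h04 hxe hx).elim
    · rcases eq_or_eq_of_outDeg_eq_two (ho w) hu12 k41 k42 hw' with rfl | rfl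
      · exact .inl rfl
      · exact (contra he h21 h01 hxe hx).elim
  obtain ⟨e, he, hxe⟩ := exists_ne_adj_of_outDeg_eq_two (ho x₂) u₀
  obtain ⟨f, hf, hxf⟩ := exists_ne_adj_of_outDeg_eq_two (ho x₃) u₀
  have hex : D.Adj e x₃ := by
    obtain ⟨w, hw, hw'⟩ := h.exists_path_of_in he hxe k20
    rcases in₀ hw' with rfl | rfl
    · exact (as hw hxe).elim
    · exact hw
  have hfx : D.Adj f x₂ := by
    obtain ⟨w, hw, hw'⟩ := h.exists_path_of_in hf hxf k30
    rcases in₀ hw' with rfl | rfl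
    · exact hw
    · exact (as hw hxf).elim
  -- If `e = f`, then `x₂` and `e` would form a 2-cycle.
  rcases second k20 he hxe with rfl | rfl <;> rcases second k30 hf hxf with rfl | rfl
  · exact (as hxe hfx).elim
  · exact key k30 k20 (fun hw => (in₀ hw).symm) hxf hfx hxe hex
  · exact key k20 k30 in₀ hxe hex hxf hfx
  · exact (as hxe hfx).elim

end SmallDegree

lemma isIsomorphic_of_eigenvalueSet_ncard {V : Type*} [Fintype V] {D : Digraph V}
    (hD : D.IsOriented) (hc : D.IsConnected) (h2 : D.eigenvalueSet.ncard = 2) :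
    D.IsIsomorphic directedEdge ∨ D.IsIsomorphic directedTriangle ∨
      D.IsIsomorphic orientedK33 ∨ D.IsIsomorphic orientedK55 := by
  classical
  obtain ⟨x, y, hxy, a, b, h⟩ := exists_quadraticCounts hD h2
  by_cases ha : a = 0
  · subst ha
    rcases h.degree_cases hD hxy with rfl | ⟨rfl, ho⟩ | ⟨rfl, hd⟩
    · exact .inl (h.isIsomorphic_directedEdge hD hc hxy)
    · exact .inr (.inr (.inl (h.isIsomorphic_orientedK33 hD hc ho hxy)))
    · exact .inr (.inr (.inr (h.isIsomorphic_orientedK55 hD hc hd x)))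
  · obtain ⟨rfl, hd⟩ := h.of_ne_zero hD hxy ha
    have hb := h.outDeg_add_inDeg hD x
    obtain rfl : b = 2 := by have := hd x; omega
    exact .inr (.inl (h.isIsomorphic_directedTriangle hD hc hxy))

end Digraph

theorem theorem1 :
    -- the characterization
    (∀ (V : Type*) [Fintype V] (D : Digraph V), D.IsOriented → D.IsConnected →
      D.eigenvalueSet.ncard = 2 →
        D.IsIsomorphic Digraph.directedEdge ∨
        D.IsIsomorphic Digraph.directedTriangle ∨
        D.IsIsomorphic Digraph.orientedK33 ∨
        D.IsIsomorphic Digraph.orientedK55) ∧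
    -- (a) the directed edge
    (Digraph.directedEdge.IsOriented ∧ Digraph.directedEdge.IsConnected ∧
      Digraph.directedEdge.eigenvalueSet = {1, -1}) ∧
    -- (b) the directed triangle
    (Digraph.directedTriangle.IsOriented ∧ Digraph.directedTriangle.IsConnected ∧
      Digraph.directedTriangle.eigenvalueSet = {1, -2}) ∧
    -- (c) the orientation of `K_{3,3}`
    (Digraph.orientedK33.IsOriented ∧ Digraph.orientedK33.IsConnected ∧
      Digraph.orientedK33.toSimpleGraphInclusive = completeBipartiteGraph (Fin 3) (Fin 3) ∧
      Digraph.orientedK33.eigenvalueSet = {(Real.sqrt 3 : ℂ), -(Real.sqrt 3 : ℂ)}) ∧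
    -- (d) the orientation of `K_{5,5}` minus a perfect matching
    (Digraph.orientedK55.IsOriented ∧ Digraph.orientedK55.IsConnected ∧
      Digraph.orientedK55.toSimpleGraphInclusive =
        (completeBipartiteGraph (ZMod 5) (ZMod 5)).deleteEdges
          (Set.range fun i : ZMod 5 => s(Sum.inl i, Sum.inr i)) ∧
      Digraph.orientedK55.eigenvalueSet = {2, -2}) := by
  refine ⟨fun V _ D hD hc h2 => Digraph.isIsomorphic_of_eigenvalueSet_ncard hD hc h2, ?_, ?_, ?_, ?_⟩
  · exact ⟨Digraph.directedEdge_isOriented, Digraph.directedEdge_isConnected,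
      Digraph.directedEdge_eigenvalueSet⟩
  · exact ⟨Digraph.directedTriangle_isOriented, Digraph.directedTriangle_isConnected,
      Digraph.directedTriangle_eigenvalueSet⟩
  · exact ⟨Digraph.orientedK33_isOriented, Digraph.orientedK33_isConnected,
      Digraph.orientedK33_toSimpleGraphInclusive, Digraph.orientedK33_eigenvalueSet⟩
  · exact ⟨Digraph.orientedK55_isOriented, Digraph.orientedK55_isConnected,
      Digraph.orientedK55_toSimpleGraphInclusive, Digraph.orientedK55_eigenvalueSet⟩
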